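/- Let $n\ge 1$ and let $\mathfrak S_n$ be the set of permutations of $\{1,\dots,n\}$. For $\sigma\in\mathfrak S_n$ let $wex(\sigma)$ be the number of weak exceedances of $\sigma$, i.e. of $i$ with $\sigma(i)\ge i$, and let $cr(\sigma)$ be the number of crossings of $\sigma$, i.e. of pairs $(i,j)$ such that either $i<j\le\sigma(i)<\sigma(j)$ or $\sigma(i)<\sigma(j)<i<j$. Let $q$ be an indeterminate, $[k]_q=\frac{1-q^k}{1-q}=1+q+\dots+q^{k-1}$, and let the $q$-tangent numbers $E_{2m+1}(q)\in\mathbb Z[q]$, $m\ge 0$, be defined by the continued fraction expansion (in formal power series in $x$) $$\sum_{m\ge 0}E_{2m+1}(q)\,x^m=\cfrac{1}{1-\cfrac{[1]_q[2]_q\,x}{1-\cfrac{[2]_q[3]_q\,x}{1-\cfrac{[3]_q[4]_q\,x}{\ddots}}}}.$$ Then $$\sum_{\sigma\in\mathfrak S_n}(-1)^{wex(\sigma)}q^{cr(\sigma)}=\begin{cases}0&\text{if } n \text{ is even},\\ (-1)^{\frac{n+1}{2}}E_n(q)&\text{if } n \text{ is odd}.\end{cases}$$ -/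

import Mathlib

open scoped Polynomial PowerSeries

/-- The number of weak exceedances of `σ`: the positions `i` with `σ i ≥ i`. -/
def wex {n : ℕ} (σ : Equiv.Perm (Fin n)) : ℕ :=
  (Finset.univ.filter fun i : Fin n => i ≤ σ i).card

/-- The number of crossings of `σ`: the pairs `(i, j)` such that either
`i < j ≤ σ i < σ j` or `σ i < σ j < i < j`. -/
def crossings {n : ℕ} (σ : Equiv.Perm (Fin n)) : ℕ :=
  (Finset.univ.filter fun p : Fin n × Fin n =>
    (p.1 < p.2 ∧ p.2 ≤ σ p.1 ∧ σ p.1 < σ p.2) ∨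
      (σ p.1 < σ p.2 ∧ σ p.2 < p.1 ∧ p.1 < p.2)).card

/-- The `q`-integer `[n]_q = 1 + q + ⋯ + q^(n-1)`, as a polynomial in the indeterminate `q`. -/
noncomputable def qInt (n : ℕ) : ℤ[X] := ∑ i ∈ Finset.range n, Polynomial.X ^ i

/-- The usual form of the `q`-integer: `[n]_q (1 - q) = 1 - q^n`. -/
theorem qInt_mul_one_sub (n : ℕ) :
    qInt n * (1 - Polynomial.X) = 1 - Polynomial.X ^ n := by
  unfold qInt
  exact geom_sum_mul_neg _ n

/-- The finite continued fraction of depth `N`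
`1 / (1 - c 0 x / (1 - c 1 x / (⋯ / (1 - c (N-1) x))))`
as a formal power series in `x`. Each division is by a series of constant term `1`. -/
noncomputable def cfConvergent {R : Type*} [CommRing R] : ℕ → (ℕ → R) → R⟦X⟧
  | 0, _ => 1
  | N + 1, c =>
      PowerSeries.invOfUnit
        (1 - PowerSeries.C (c 0) * PowerSeries.X * cfConvergent N fun k => c (k + 1)) 1

/-- The infinite continued fraction `1 / (1 - c 0 x / (1 - c 1 x / (1 - c 2 x / ⋯)))`, the
limit of its convergents in the ring of formal power series: the coefficient of `x ^ n` is the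
one of the convergent of depth `n`, and of all deeper ones (`coeff_cfConvergent`). -/
noncomputable def contFrac {R : Type*} [CommRing R] (c : ℕ → R) : R⟦X⟧ :=
  PowerSeries.mk fun n => PowerSeries.coeff n (cfConvergent n c)

theorem cfConvergent_mul {R : Type*} [CommRing R] (N : ℕ) (c : ℕ → R) :
    (1 - PowerSeries.C (c 0) * PowerSeries.X * cfConvergent N fun k => c (k + 1)) *
      cfConvergent (N + 1) c = 1 := by
  rw [cfConvergent]
  exact PowerSeries.mul_invOfUnit _ 1 (by simp)

theorem X_pow_dvd_cfConvergent_sub {R : Type*} [CommRing R] (n : ℕ) :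
    ∀ (N M : ℕ) (c : ℕ → R), n ≤ N → n ≤ M →
      (PowerSeries.X : R⟦X⟧) ^ (n + 1) ∣ cfConvergent N c - cfConvergent M c := by
  have key : ∀ (n N M : ℕ) (c : ℕ → R),
      (PowerSeries.X : R⟦X⟧) ^ n ∣
        cfConvergent N (fun k => c (k + 1)) - cfConvergent M (fun k => c (k + 1)) →
      (PowerSeries.X : R⟦X⟧) ^ (n + 1) ∣ cfConvergent (N + 1) c - cfConvergent (M + 1) c := by
    rintro n N M c ⟨d, hd⟩
    refine ⟨PowerSeries.C (c 0) * d * cfConvergent (N + 1) c * cfConvergent (M + 1) c, ?_⟩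
    have h1 := cfConvergent_mul N c
    have h2 := cfConvergent_mul M c
    linear_combination cfConvergent (M + 1) c * h1 - cfConvergent (N + 1) c * h2 +
      PowerSeries.C (c 0) * PowerSeries.X * cfConvergent (N + 1) c * cfConvergent (M + 1) c * hd
  have one : ∀ (N : ℕ) (c : ℕ → R),
      (PowerSeries.X : R⟦X⟧) ∣ cfConvergent N c - 1 := by
    intro N c
    cases N with
    | zero => simp [cfConvergent]
    | succ N =>
      have h := cfConvergent_mul N c
      refine ⟨PowerSeries.C (c 0) * (cfConvergent N fun k => c (k + 1)) *
        cfConvergent (N + 1) c, ?_⟩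
      linear_combination h
  induction n with
  | zero =>
    intro N M c _ _
    have h := dvd_sub (one N c) (one M c)
    simpa using h
  | succ n ih =>
    intro N M c hN hM
    obtain ⟨N, rfl⟩ : ∃ k, N = k + 1 := ⟨N - 1, by omega⟩
    obtain ⟨M, rfl⟩ : ∃ k, M = k + 1 := ⟨M - 1, by omega⟩
    exact key (n + 1) N M c (ih N M _ (by omega) (by omega))

/-- The convergents do converge, coefficient by coefficient, to the continued fraction. -/
theorem coeff_cfConvergent {R : Type*} [CommRing R] (c : ℕ → R) {n N : ℕ} (h : n ≤ N) :
    PowerSeries.coeff n (cfConvergent N c) = PowerSeries.coeff n (contFrac c) := by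
  have hd := PowerSeries.X_pow_dvd_iff.mp
    (X_pow_dvd_cfConvergent_sub n N n c h le_rfl) n (Nat.lt_succ_self n)
  rw [map_sub, sub_eq_zero] at hd
  rw [hd, contFrac, PowerSeries.coeff_mk]

/-- `qTangent m` is the `q`-tangent number `E_{2m+1}(q)`, defined by
`∑ E_{2m+1}(q) x^m = 1 / (1 - [1][2] x / (1 - [2][3] x / (1 - [3][4] x / ⋯)))`. -/
noncomputable def qTangent (m : ℕ) : ℤ[X] :=
  PowerSeries.coeff m (contFrac fun k => qInt (k + 1) * qInt (k + 2))

/-!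
Call an arc `i ↦ σ i` upper if `i ≤ σ i` and lower otherwise. Sum the weights `y ^ wex * q ^ cr`
over the permutations whose matrix has an empty `h × h` corner. Forcing the corner to be empty with
one more row, then also with one more column, leaves out the permutations having a lower arc from
`h`, then those having an upper arc to `h`; deleting that arc `i ↦ v` removes `i - 1 - v`,
respectively `v - i`, crossings.
The generating functions of these sums hence obey the recurrence of Motzkin paths with level weights
`y[h+1] + [h]` and fall weights `y[h]²`, which has only one solution in power series.

At `y = -1` the weights are `a h - a (h + 1)` and `-(a h)²` with `a h = [h]`. For such weights, with
any sequence `a` starting at `0`, the recurrence is solved by hand: its solution at height `0` is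
`1 - a 1 x T(-x²)`, where `T` is the continued fraction with coefficients `a (k + 1) a (k + 2)`.
-/

open Finset PowerSeries

section InsertPoint

variable {n : ℕ}

/-- The permutation of `Fin (n + 1)` that maps `i` to `v` and acts as `τ` on the other points,
after the order-preserving relabelling of domain and codomain: it adds the arc `i ↦ v` to `τ`. -/
def insertPoint (i v : Fin (n + 1)) (τ : Equiv.Perm (Fin n)) : Equiv.Perm (Fin (n + 1)) :=
  (finSuccEquiv' i).trans (τ.optionCongr.trans (finSuccEquiv' v).symm)

@[simp]
theorem insertPoint_self (i v : Fin (n + 1)) (τ : Equiv.Perm (Fin n)) :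
    insertPoint i v τ i = v := by
  simp [insertPoint]

@[simp]
theorem insertPoint_succAbove (i v : Fin (n + 1)) (τ : Equiv.Perm (Fin n)) (j : Fin n) :
    insertPoint i v τ (i.succAbove j) = v.succAbove (τ j) := by
  simp [insertPoint]

theorem insertPoint_injective (i v : Fin (n + 1)) : Function.Injective (insertPoint i v) := by
  intro τ τ' h
  ext1 j
  simpa using DFunLike.congr_fun h (i.succAbove j)

theorem insertPoint_bijective (i : Fin (n + 1)) :
    Function.Bijective fun p : Fin (n + 1) × Equiv.Perm (Fin n) => insertPoint i p.1 p.2 := by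
  rw [Fintype.bijective_iff_injective_and_card]
  refine ⟨?_, by simp [Fintype.card_perm, Nat.factorial_succ]⟩
  rintro ⟨v, τ⟩ ⟨v', τ'⟩ h
  obtain rfl : v = v' := by simpa using DFunLike.congr_fun h i
  exact congrArg _ (insertPoint_injective i v h)

theorem exists_insertPoint_eq {i v : Fin (n + 1)} {σ : Equiv.Perm (Fin (n + 1))} (h : σ i = v) :
    ∃ τ, insertPoint i v τ = σ := by
  obtain ⟨⟨w, τ⟩, rfl⟩ := (insertPoint_bijective i).surjective σ
  exact ⟨τ, by rw [← h, insertPoint_self]⟩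

theorem sum_filter_apply_eq {M : Type*} [AddCommMonoid M] (i v : Fin (n + 1))
    (p : Equiv.Perm (Fin (n + 1)) → Prop) [DecidablePred p] (f : Equiv.Perm (Fin (n + 1)) → M) :
    ∑ σ with p σ ∧ σ i = v, f σ = ∑ τ with p (insertPoint i v τ), f (insertPoint i v τ) := by
  symm
  refine sum_bij (fun τ _ => insertPoint i v τ) (by simp)
    (fun τ _ τ' _ h => insertPoint_injective i v h) ?_ fun _ _ => rfl
  intro σ hσ
  obtain ⟨hp, hi⟩ := (mem_filter_univ σ).1 hσ
  obtain ⟨τ, rfl⟩ := exists_insertPoint_eq hi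
  exact ⟨τ, by simpa using hp, rfl⟩

end InsertPoint

section Statistics

variable {n : ℕ}

/-- The arcs `i ↦ a` and `j ↦ b` cross, in this order: `crossings σ` counts the pairs `(i, j)`
for which `i ↦ σ i` and `j ↦ σ j` do. -/
def ArcCross (i a j b : ℕ) : Prop :=
  (i < j ∧ j ≤ a ∧ a < b) ∨ (a < b ∧ b < i ∧ i < j)

instance (i a j b : ℕ) : Decidable (ArcCross i a j b) := by
  unfold ArcCross; infer_instance

theorem crossings_eq_sum (σ : Equiv.Perm (Fin n)) :
    crossings σ = ∑ i : Fin n, ∑ j : Fin n, if ArcCross i (σ i) j (σ j) then 1 else 0 := by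
  rw [crossings, card_filter, Fintype.sum_prod_type]
  rfl

theorem wex_eq_sum (σ : Equiv.Perm (Fin n)) :
    wex σ = ∑ i : Fin n, if (i : ℕ) ≤ σ i then 1 else 0 := by
  rw [wex, card_filter]
  rfl

theorem wex_insertPoint (i v : Fin (n + 1)) (τ : Equiv.Perm (Fin n))
    (h : ∀ j : Fin n, (i.succAbove j : ℕ) ≤ v.succAbove (τ j) ↔ (j : ℕ) ≤ τ j) :
    wex (insertPoint i v τ) = wex τ + if i ≤ v then 1 else 0 := by
  simp only [wex_eq_sum, Fin.sum_univ_succAbove _ i, insertPoint_self, insertPoint_succAbove, h,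
    Fin.le_def, add_comm]

theorem crossings_insertPoint (i v : Fin (n + 1)) (τ : Equiv.Perm (Fin n))
    (h : ∀ j k : Fin n, ArcCross (i.succAbove j) (v.succAbove (τ j)) (i.succAbove k)
      (v.succAbove (τ k)) ↔ ArcCross j (τ j) k (τ k)) :
    crossings (insertPoint i v τ) = crossings τ +
      #{j : Fin n | ArcCross i v (i.succAbove j) (v.succAbove (τ j)) ∨
        ArcCross (i.succAbove j) (v.succAbove (τ j)) i v} := by
  have irrefl : ¬ ArcCross i v i v := by simp [ArcCross]
  have exclusive (j : Fin n) (h₁ : ArcCross i v (i.succAbove j) (v.succAbove (τ j))) :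
      ¬ ArcCross (i.succAbove j) (v.succAbove (τ j)) i v := by
    unfold ArcCross at *
    omega
  rw [filter_or, card_union_of_disjoint (disjoint_filter.2 fun j _ => exclusive j), card_filter,
    card_filter]
  simp only [crossings_eq_sum, Fin.sum_univ_succAbove _ i, insertPoint_self,
    insertPoint_succAbove, h, sum_add_distrib, if_neg irrefl]
  ring

theorem val_succAbove (i : Fin (n + 1)) (j : Fin n) :
    (i.succAbove j : ℕ) = if (j : ℕ) < i then (j : ℕ) else j + 1 := by
  simp only [Fin.succAbove, Fin.lt_def, Fin.val_castSucc]
  split_ifs <;> simp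

theorem card_filter_le_and_lt (a : ℕ) {b : ℕ} (hb : b ≤ n) :
    #{j : Fin n | a ≤ (j : ℕ) ∧ (j : ℕ) < b} = b - a := by
  rw [← Nat.card_Ico, ← card_map Fin.valEmbedding]
  congr 1
  ext j
  simp only [mem_map, mem_filter_univ, Fin.valEmbedding_apply, mem_Ico]
  exact ⟨by rintro ⟨j, hj, rfl⟩; exact hj, fun hj => ⟨⟨j, by omega⟩, hj, rfl⟩⟩

end Statistics

section EmptyCorner

variable {n : ℕ}

/-- The `u × l` corner of the permutation matrix of `σ` is empty: no arc starts below `u` and ends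
below `l`. -/
def EmptyCorner (u l : ℕ) (σ : Equiv.Perm (Fin n)) : Prop :=
  ∀ i : Fin n, (i : ℕ) < u → l ≤ (σ i : ℕ)

instance (u l : ℕ) : DecidablePred (EmptyCorner (n := n) u l) := fun σ => by
  unfold EmptyCorner; infer_instance

theorem emptyCorner_zero_left (l : ℕ) (σ : Equiv.Perm (Fin n)) : EmptyCorner 0 l σ :=
  fun _ hi => absurd hi (Nat.not_lt_zero _)

theorem emptyCorner_succ_left_iff (l : ℕ) (u : Fin n) (σ : Equiv.Perm (Fin n)) :
    EmptyCorner (u + 1) l σ ↔ EmptyCorner u l σ ∧ l ≤ (σ u : ℕ) := by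
  refine ⟨fun H => ⟨fun i hi => H i (by omega), H u (by omega)⟩, fun ⟨H, hu⟩ i hi => ?_⟩
  obtain h | h := Nat.lt_succ_iff_lt_or_eq.1 hi
  · exact H i h
  · rwa [Fin.ext h]

theorem emptyCorner_succ_right_iff (u : ℕ) (l : Fin n) (σ : Equiv.Perm (Fin n)) :
    EmptyCorner u (l + 1) σ ↔ EmptyCorner u l σ ∧ u ≤ (σ.symm l : ℕ) := by
  refine ⟨fun H => ⟨fun i hi => (Nat.le_succ _).trans (H i hi), ?_⟩, fun ⟨H, hl⟩ i hi => ?_⟩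
  · by_contra! h
    simpa using H _ h
  · refine lt_of_le_of_ne (H i hi) fun h => ?_
    rw [Fin.ext h, Equiv.symm_apply_apply] at hl
    omega

theorem emptyCorner_insertPoint_iff (u l : ℕ) (i v : Fin (n + 1)) (τ : Equiv.Perm (Fin n)) :
    EmptyCorner u l (insertPoint i v τ) ↔ ((i : ℕ) < u → l ≤ (v : ℕ)) ∧
      ∀ j : Fin n, (i.succAbove j : ℕ) < u → l ≤ (v.succAbove (τ j) : ℕ) := by
  rw [EmptyCorner, Fin.forall_iff_succAbove i]
  simp

theorem not_emptyCorner_self {h : ℕ} (hh : h ≠ 0) (σ : Equiv.Perm (Fin h)) :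
    ¬ EmptyCorner h h σ := fun H => by
  have := H ⟨0, Nat.pos_of_ne_zero hh⟩ (Nat.pos_of_ne_zero hh)
  omega

section UpperArc

variable {i v : Fin (n + 1)} {τ : Equiv.Perm (Fin n)}

theorem emptyCorner_insertPoint_of_le (hiv : i ≤ v) :
    EmptyCorner (v + 1) v (insertPoint i v τ) ↔ EmptyCorner v v τ := by
  rw [Fin.le_def] at hiv
  rw [emptyCorner_insertPoint_iff, EmptyCorner]
  simp only [val_succAbove]
  refine ⟨fun ⟨_, H⟩ j hj => ?_, fun H => ⟨by omega, fun j hj => ?_⟩⟩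
  all_goals have := H j; split_ifs at * <;> omega

theorem wex_insertPoint_of_le (hiv : i ≤ v) (hτ : EmptyCorner v v τ) :
    wex (insertPoint i v τ) = wex τ + 1 := by
  rw [wex_insertPoint, if_pos hiv]
  intro j
  have := hτ j
  rw [Fin.le_def] at hiv
  simp only [val_succAbove]
  split_ifs <;> omega

theorem crossings_insertPoint_of_le (hiv : i ≤ v) (hτ : EmptyCorner v v τ) :
    crossings (insertPoint i v τ) = crossings τ + (v - i) := by
  rw [Fin.le_def] at hiv
  rw [crossings_insertPoint, ← card_filter_le_and_lt i (Nat.lt_succ_iff.1 v.isLt)]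
  · congr 2
    ext j
    have := hτ j
    simp only [mem_filter_univ, val_succAbove, ArcCross]
    split_ifs <;> omega
  · intro j k
    have := hτ j
    have := hτ k
    simp only [val_succAbove, ArcCross]
    split_ifs <;> omega

end UpperArc

section LowerArc

variable {i v : Fin (n + 1)} {τ : Equiv.Perm (Fin n)}

theorem emptyCorner_insertPoint_of_lt (hvi : v < i) :
    EmptyCorner i i (insertPoint i v τ) ↔ EmptyCorner i (i - 1) τ := by
  rw [Fin.lt_def] at hvi
  rw [emptyCorner_insertPoint_iff, EmptyCorner]
  simp only [val_succAbove]
  refine ⟨fun ⟨_, H⟩ j hj => ?_, fun H => ⟨by omega, fun j hj => ?_⟩⟩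
  all_goals have := H j; split_ifs at * <;> omega

theorem wex_insertPoint_of_lt (hvi : v < i) (hτ : EmptyCorner i (i - 1) τ) :
    wex (insertPoint i v τ) = wex τ := by
  rw [wex_insertPoint, if_neg hvi.not_ge, add_zero]
  intro j
  have := hτ j
  rw [Fin.lt_def] at hvi
  simp only [val_succAbove]
  split_ifs <;> omega

theorem crossings_insertPoint_of_lt (hvi : v < i) (hτ : EmptyCorner i (i - 1) τ) :
    crossings (insertPoint i v τ) = crossings τ + (i - 1 - v) := by
  rw [Fin.lt_def] at hvi
  rw [crossings_insertPoint, ← card_filter_le_and_lt v (show (i : ℕ) - 1 ≤ n by omega)]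
  · congr 1
    refine card_equiv τ fun j => ?_
    have := hτ j
    simp only [mem_filter_univ, val_succAbove, ArcCross]
    split_ifs <;> omega
  · intro j k
    have := hτ j
    have := hτ k
    simp only [val_succAbove, ArcCross]
    split_ifs <;> omega

end LowerArc

end EmptyCorner

section QNum

variable {R : Type*} [Semiring R] (q : R)

/-- The `q`-integer `1 + q + ⋯ + q^(n-1)` at an element `q` of a semiring; `qInt` is the case of the
indeterminate. -/
def qNum (n : ℕ) : R := ∑ i ∈ range n, q ^ i

theorem sum_filter_lt_pow_eq_qNum {n h : ℕ} (hn : h ≤ n) :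
    ∑ j : Fin n with j.val < h, q ^ (h - 1 - j.val) = qNum q h := by
  rw [qNum, ← sum_range_reflect]
  refine sum_bij (fun j _ => (j : ℕ)) (by simp) (fun _ _ _ _ h => Fin.ext h) (fun j hj => ?_)
    fun _ _ => rfl
  rw [mem_range] at hj
  exact ⟨⟨j, by omega⟩, by simpa using hj, rfl⟩

end QNum

theorem sum_filter_eq_add_sum_fiber {ι κ M : Type*} [Fintype ι] [Fintype κ] [DecidableEq κ]
    [AddCommMonoid M] (p : ι → Prop) [DecidablePred p] (g : ι → κ) (r : κ → Prop) [DecidablePred r]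
    (f : ι → M) :
    ∑ x with p x, f x =
      ∑ x with p x ∧ r (g x), f x + ∑ k with ¬ r k, ∑ x with p x ∧ g x = k, f x := by
  rw [← sum_filter_add_sum_filter_not _ (fun x => r (g x)), filter_filter, filter_filter]
  congr 1
  rw [← sum_fiberwise_of_maps_to (g := g) (t := {k | ¬ r k}) (by simp)]
  refine sum_congr rfl fun k hk => ?_
  rw [mem_filter_univ] at hk
  rw [filter_filter]
  refine sum_congr (filter_congr fun x _ => ?_) fun _ _ => rfl
  constructor
  · exact fun ⟨⟨hp, _⟩, hg⟩ => ⟨hp, hg⟩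
  · rintro ⟨hp, rfl⟩
    exact ⟨⟨hp, hk⟩, rfl⟩

section CornerSum

variable {R : Type*} [CommSemiring R] (y q : R)

/-- The joint weight of the weak exceedances and the crossings of `σ`. -/
def permWeight {n : ℕ} (σ : Equiv.Perm (Fin n)) : R := y ^ wex σ * q ^ crossings σ

/-- The total weight of the permutations of `Fin n` with empty `u × l` corner. -/
def cornerSum (n u l : ℕ) : R := ∑ σ : Equiv.Perm (Fin n) with EmptyCorner u l σ, permWeight y q σ

theorem sum_permWeight_upperArc {n : ℕ} {i v : Fin (n + 1)} (hiv : i ≤ v) :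
    ∑ σ with EmptyCorner (v + 1) v σ ∧ σ i = v, permWeight y q σ =
      y * q ^ (v - i : ℕ) * cornerSum y q n v v := by
  simp only [sum_filter_apply_eq, emptyCorner_insertPoint_of_le hiv, cornerSum, mul_sum]
  refine sum_congr rfl fun τ hτ => ?_
  rw [mem_filter_univ] at hτ
  rw [permWeight, permWeight, wex_insertPoint_of_le hiv hτ, crossings_insertPoint_of_le hiv hτ]
  ring

theorem sum_permWeight_lowerArc {n : ℕ} {i v : Fin (n + 1)} (hvi : v < i) :
    ∑ σ with EmptyCorner i i σ ∧ σ i = v, permWeight y q σ =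
      q ^ (i - 1 - v : ℕ) * cornerSum y q n i (i - 1) := by
  simp only [sum_filter_apply_eq, emptyCorner_insertPoint_of_lt hvi, cornerSum, mul_sum]
  refine sum_congr rfl fun τ hτ => ?_
  rw [mem_filter_univ] at hτ
  rw [permWeight, permWeight, wex_insertPoint_of_lt hvi hτ, crossings_insertPoint_of_lt hvi hτ]
  ring

-- At `h = 0` the truncated `h - 1` is harmless, because `qNum q 0 = 0`.
theorem cornerSum_expand_row {n h : ℕ} (hn : h ≤ n) :
    cornerSum y q (n + 1) h h =
      cornerSum y q (n + 1) (h + 1) h + qNum q h * cornerSum y q n h (h - 1) := by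
  obtain ⟨i, rfl⟩ : ∃ i : Fin (n + 1), (i : ℕ) = h := ⟨⟨h, by omega⟩, rfl⟩
  rw [cornerSum, sum_filter_eq_add_sum_fiber _ (fun σ => σ i) (fun v => i.val ≤ v.val)]
  congr 1
  · simp only [cornerSum, emptyCorner_succ_left_iff]
  · rw [← sum_filter_lt_pow_eq_qNum q i.isLt.le, sum_mul]
    simp only [not_le]
    refine sum_congr rfl fun v hv => ?_
    exact sum_permWeight_lowerArc y q ((mem_filter_univ v).1 hv)

theorem cornerSum_expand_column {n h : ℕ} (hn : h ≤ n) :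
    cornerSum y q (n + 1) (h + 1) h =
      cornerSum y q (n + 1) (h + 1) (h + 1) + y * qNum q (h + 1) * cornerSum y q n h h := by
  obtain ⟨v, rfl⟩ : ∃ v : Fin (n + 1), (v : ℕ) = h := ⟨⟨h, by omega⟩, rfl⟩
  rw [cornerSum, sum_filter_eq_add_sum_fiber _ (fun σ => σ.symm v)
    (fun i => v.val + 1 ≤ i.val)]
  congr 1
  · simp only [cornerSum, emptyCorner_succ_right_iff]
  · rw [← sum_filter_lt_pow_eq_qNum q v.isLt, mul_sum, sum_mul]
    simp only [not_le, Equiv.symm_apply_eq, eq_comm (a := v)]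
    refine sum_congr rfl fun i hi => ?_
    exact sum_permWeight_upperArc y q (Nat.lt_succ_iff.1 ((mem_filter_univ i).1 hi))

theorem cornerSum_zero_recurrence (n : ℕ) :
    cornerSum y q (n + 1) 0 0 = cornerSum y q (n + 1) 1 1 +
      (y * qNum q 1 + qNum q 0) * cornerSum y q n 0 0 := by
  rw [cornerSum_expand_row y q n.zero_le, cornerSum_expand_column y q n.zero_le]
  simp only [zero_add, zero_tsub]
  ring

theorem cornerSum_succ_recurrence {n h : ℕ} (hn : h ≤ n) :
    cornerSum y q (n + 2) (h + 1) (h + 1) = cornerSum y q (n + 2) (h + 2) (h + 2) +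
      (y * qNum q (h + 2) + qNum q (h + 1)) * cornerSum y q (n + 1) (h + 1) (h + 1) +
      y * qNum q (h + 1) ^ 2 * cornerSum y q n h h := by
  rw [cornerSum_expand_row y q (by omega), cornerSum_expand_column y q (by omega),
    Nat.add_sub_cancel, cornerSum_expand_column y q hn]
  ring

theorem cornerSum_self (h : ℕ) : cornerSum y q h h h = if h = 0 then 1 else 0 := by
  split_ifs with hh
  · subst hh
    simp [cornerSum, EmptyCorner, permWeight, wex, crossings]
  · simp [cornerSum, not_emptyCorner_self hh]

theorem cornerSum_zero (n : ℕ) :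
    cornerSum y q n 0 0 = ∑ σ : Equiv.Perm (Fin n), permWeight y q σ := by
  simp [cornerSum, emptyCorner_zero_left]

end CornerSum

section Motzkin

variable {R : Type*} [Semiring R]

/-- `W h` is the generating function, by length, of the Motzkin paths from height `h` to height `0`
whose level steps at height `k` have weight `b k`, whose falls from height `k + 1` have weight
`lam (k + 1)`, and whose rises have weight `1`. Only the first-step recurrence is recorded; it
determines `W` (`IsMotzkinFamily.unique`). -/
structure IsMotzkinFamily (b lam : ℕ → R) (W : ℕ → R⟦X⟧) : Prop where
  zero : W 0 = 1 + X * (W 1 + C (b 0) * W 0)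
  succ (h : ℕ) : W (h + 1) = X * (W (h + 2) + C (b (h + 1)) * W (h + 1) + C (lam (h + 1)) * W h)

theorem IsMotzkinFamily.unique {b lam : ℕ → R} {V W : ℕ → R⟦X⟧} (hV : IsMotzkinFamily b lam V)
    (hW : IsMotzkinFamily b lam W) : V = W := by
  suffices ∀ m h, coeff m (V h) = coeff m (W h) from funext fun h => PowerSeries.ext (this · h)
  intro m
  induction m with
  | zero =>
    rintro (- | h)
    · rw [hV.zero, hW.zero]
      simp only [map_add, coeff_zero_X_mul]
    · rw [hV.succ, hW.succ, coeff_zero_X_mul, coeff_zero_X_mul]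
  | succ m ih =>
    rintro (- | h)
    · rw [hV.zero, hW.zero]
      simp only [map_add, coeff_succ_X_mul, coeff_C_mul, ih]
    · rw [hV.succ, hW.succ]
      simp only [map_add, coeff_succ_X_mul, coeff_C_mul, ih]

end Motzkin

section CornerSeries

variable {R : Type*} [CommSemiring R] (y q : R)

/-- The generating function of the permutations with empty `h × h` corner, by size minus `h`. -/
def cornerSeries (h : ℕ) : R⟦X⟧ := mk fun m => cornerSum y q (h + m) h h

theorem coeff_cornerSeries_zero (n : ℕ) :
    coeff n (cornerSeries y q 0) = ∑ σ : Equiv.Perm (Fin n), y ^ wex σ * q ^ crossings σ := by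
  rw [cornerSeries, coeff_mk, zero_add, cornerSum_zero]
  rfl

theorem isMotzkinFamily_cornerSeries :
    IsMotzkinFamily (fun h => y * qNum q (h + 1) + qNum q h) (fun h => y * qNum q h ^ 2)
      (cornerSeries y q) where
  zero := by
    ext (- | m)
    · simp [cornerSeries, cornerSum_self]
    · rw [map_add, coeff_one, if_neg m.succ_ne_zero, zero_add, coeff_succ_X_mul, map_add,
        coeff_C_mul]
      simp only [cornerSeries, coeff_mk, zero_add, add_comm 1 m, cornerSum_zero_recurrence]
  succ h := by
    ext (- | m)
    · simp [cornerSeries, cornerSum_self]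
    · rw [coeff_succ_X_mul, map_add, map_add, coeff_C_mul, coeff_C_mul]
      simp only [cornerSeries, coeff_mk]
      rw [show h + 1 + (m + 1) = h + m + 2 by ring, show h + 2 + m = h + m + 2 by ring,
        show h + 1 + m = h + m + 1 by ring, cornerSum_succ_recurrence y q (Nat.le_add_right h m)]

end CornerSeries

section ContinuedFraction

variable {R : Type*} [CommRing R] (c : ℕ → R)

theorem X_pow_dvd_contFrac_sub (N : ℕ) :
    (X : R⟦X⟧) ^ (N + 1) ∣ contFrac c - cfConvergent N c := by
  rw [X_pow_dvd_iff]
  intro m hm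
  rw [map_sub, coeff_cfConvergent c (Nat.lt_succ_iff.1 hm), sub_self]

theorem contFrac_mul : (1 - C (c 0) * X * contFrac fun k => c (k + 1)) * contFrac c = 1 := by
  rw [← sub_eq_zero]
  ext m
  refine X_pow_dvd_iff.1 ?_ m m.lt_add_one
  obtain ⟨d, hd⟩ := X_pow_dvd_contFrac_sub c (m + 1)
  obtain ⟨e, he⟩ := X_pow_dvd_contFrac_sub (fun k => c (k + 1)) m
  refine ⟨X * d * (1 - C (c 0) * X * contFrac fun k => c (k + 1)) -
    C (c 0) * X * cfConvergent (m + 1) c * e, ?_⟩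
  linear_combination cfConvergent_mul m c + (1 - C (c 0) * X * contFrac fun k => c (k + 1)) * hd -
    C (c 0) * X * cfConvergent (m + 1) c * he

/-- The tail `1 / (1 + c k x² / (1 + c (k + 1) x² / ⋯))` of the continued fraction at `-x²`. -/
noncomputable def alternatingTail (k : ℕ) : R⟦X⟧ :=
  expand 2 two_ne_zero (rescale (-1) (contFrac fun j => c (j + k)))

theorem alternatingTail_eq (k : ℕ) :
    alternatingTail c k =
      1 - C (c k) * X ^ 2 * alternatingTail c k * alternatingTail c (k + 1) := by
  have rescale_C (r : R) : rescale (-1) (C r) = C r := by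
    ext (- | n) <;> simp [coeff_rescale, coeff_C]
  have h := congrArg (fun f => expand 2 two_ne_zero (rescale (-1) f))
    (contFrac_mul fun j => c (j + k))
  simp only [map_sub, map_mul, map_one, rescale_C, rescale_X, expand_C, expand_X, map_neg,
    zero_add, Nat.add_right_comm _ 1 k] at h
  simp only [alternatingTail, ← add_assoc]
  linear_combination h

theorem coeff_alternatingTail_zero (n : ℕ) :
    coeff n (alternatingTail c 0) =
      if 2 ∣ n then (-1) ^ (n / 2) * coeff (n / 2) (contFrac c) else 0 := by
  simp only [alternatingTail, coeff_expand, coeff_rescale, add_zero]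

/-- The solution of the Motzkin recurrence with level weights `a h - a (h + 1)` and fall weights
`-(a h) ^ 2` in terms of the tails of a continued fraction. -/
noncomputable def tailSeries (a : ℕ → R) (h : ℕ) : R⟦X⟧ :=
  (1 - C (a (h + 1)) * X * alternatingTail (fun k => a (k + 1) * a (k + 2)) h) *
    ∏ k ∈ range h, (-(C (a (k + 1)) ^ 2 * X * alternatingTail (fun k => a (k + 1) * a (k + 2)) k))

theorem isMotzkinFamily_tailSeries {a : ℕ → R} (ha : a 0 = 0) :
    IsMotzkinFamily (fun h => a h - a (h + 1)) (fun h => -a h ^ 2) (tailSeries a) where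
  zero := by
    have h₀ := alternatingTail_eq (fun k => a (k + 1) * a (k + 2)) 0
    simp only [map_mul, zero_add] at h₀
    simp only [tailSeries, prod_range_succ, prod_range_zero, zero_add, one_mul, ha, map_sub,
      map_zero]
    linear_combination (-C (a 1) * X) * h₀
  succ h := by
    have h₀ := alternatingTail_eq (fun k => a (k + 1) * a (k + 2)) h
    have h₁ := alternatingTail_eq (fun k => a (k + 1) * a (k + 2)) (h + 1)
    simp only [map_mul, add_assoc, Nat.reduceAdd] at h₀ h₁
    simp only [tailSeries, prod_range_succ, add_assoc, Nat.reduceAdd, map_sub, map_neg, map_pow]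
    generalize ∏ k ∈ range h,
      (-(C (a (k + 1)) ^ 2 * X * alternatingTail (fun k => a (k + 1) * a (k + 2)) k)) = P
    linear_combination C (a (h + 1)) ^ 2 * X * P *
      (C (a (h + 2)) * X * alternatingTail (fun k => a (k + 1) * a (k + 2)) h * h₁ - h₀)

end ContinuedFraction

section SignedSum

variable {R : Type*} [CommRing R] (q : R)

theorem cornerSeries_neg_one : cornerSeries (-1) q = tailSeries (qNum q) := by
  have h := isMotzkinFamily_cornerSeries (-1) q
  simp only [neg_one_mul, neg_add_eq_sub] at h
  exact h.unique (isMotzkinFamily_tailSeries (by simp [qNum]))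

theorem sum_neg_one_pow_wex_mul_pow_crossings (n : ℕ) :
    ∑ σ : Equiv.Perm (Fin (n + 1)), (-1 : R) ^ wex σ * q ^ crossings σ =
      -coeff n (alternatingTail (fun k => qNum q (k + 1) * qNum q (k + 2)) 0) := by
  have qNum_one : qNum q 1 = 1 := by simp [qNum]
  rw [← coeff_cornerSeries_zero, cornerSeries_neg_one, tailSeries, prod_range_zero, mul_one,
    zero_add, qNum_one, map_one, one_mul, map_sub, coeff_one, if_neg n.succ_ne_zero, zero_sub,
    coeff_succ_X_mul]

theorem theorem1_general (n : ℕ) (hn : 1 ≤ n) :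
    (Even n → ∑ σ : Equiv.Perm (Fin n), (-1 : R) ^ wex σ * q ^ crossings σ = 0) ∧
    (∀ m : ℕ, n = 2 * m + 1 →
      ∑ σ : Equiv.Perm (Fin n), (-1 : R) ^ wex σ * q ^ crossings σ =
        (-1 : R) ^ ((n + 1) / 2) *
          coeff m (contFrac fun k => qNum q (k + 1) * qNum q (k + 2))) := by
  obtain ⟨n, rfl⟩ := Nat.exists_eq_add_of_le' hn
  rw [sum_neg_one_pow_wex_mul_pow_crossings, coeff_alternatingTail_zero]
  constructor
  · intro heven
    rw [if_neg (by grind), neg_zero]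
  · intro m hm
    obtain rfl : n = 2 * m := by omega
    rw [if_pos (Dvd.intro _ rfl), Nat.mul_div_cancel_left _ two_pos,
      show (2 * m + 1 + 1) / 2 = m + 1 by omega]
    ring

end SignedSum

theorem theorem1 (n : ℕ) (hn : 1 ≤ n) :
    (Even n →
      ∑ σ : Equiv.Perm (Fin n),
        (-1 : ℤ[X]) ^ wex σ * (Polynomial.X : ℤ[X]) ^ crossings σ = 0) ∧
    (∀ m : ℕ, n = 2 * m + 1 →
      ∑ σ : Equiv.Perm (Fin n),
        (-1 : ℤ[X]) ^ wex σ * (Polynomial.X : ℤ[X]) ^ crossings σ =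
          (-1 : ℤ[X]) ^ ((n + 1) / 2) * qTangent m) :=
  theorem1_general Polynomial.X n hn
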